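/- Let $n\ge 2$, let $\Omega\subset\mathbb R^n$ be open, bounded and connected (and non-empty), let $f\in L^2(\Omega)$ and $\ell(v)=\int_\Omega f v\,dx$. For $\delta>0$ put $\Omega_\delta=\bigcup_{x\in\Omega}B(x,\delta)$. Let $A_\delta:\mathbb R_+\to\mathbb R_+$, $\delta>0$, be radial kernels such that $\frac1n\int_{\mathbb R^n}A_\delta(|x|)\,dx=1$, $A_\delta(|x|)=0$ for $|x|\ge\delta$, and, for some $s\in(0,1)$ independent of $\delta$ and some $c_\delta>0$, $A_\delta(|x|)\ge c_\delta|x|^{-(n+2s-2)}$ for $0<|x|<\delta/2$. For a bounded measurable $\kappa$ on $\Omega_\delta\times\Omega_\delta$ let $$a_{\delta,\kappa}(u,v)=\int_{\Omega_\delta}\int_{\Omega_\delta}\kappa(x,x')A_\delta(|x-x'|)\frac{u(x)-u(x')}{|x-x'|}\,\frac{v(x)-v(x')}{|x-x'|}\,dx\,dx'.$$ Let $\mathcal U^\delta=\{u\in L^2(\Omega_\delta): a_{\delta,1}(u,u)<\infty\}$, and let $\mathcal U^\delta_0$ be the set of those $u\in\mathcal U^\delta$ that vanish a.e. in $\Omega_\delta\setminus\Omega$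 and are limits, with respect to $a_{\delta,1}(\cdot,\cdot)$, of functions in $C_c^\infty(\Omega)$ (extended by $0$). Let $p\ge1$, $0<\rho_{\min}<\rho_{\max}<\infty$ and $\delta_0>0$. Let $\rho_\delta$ ($0<\delta<\delta_0$) and $\rho$ be elements of $L^\infty(\Omega_{\delta_0})$ with $\rho_{\min}\le\rho_\delta,\rho\le\rho_{\max}$ a.e. in $\Omega_{\delta_0}$, and assume that $\rho_\delta^p\rightharpoonup\rho^p$ weak* in $L^\infty(\Omega_{\delta_0})$ as $\delta\to0$. Let $u_\delta\in\mathcal U_0^\delta$ be the solution of $$a_{\delta,\kappa_\delta}(u_\delta,v)=\ell(v)\quad\text{for all } v\in\mathcal U_0^\delta,\qquad \kappa_\delta(x,x')=\rho_\delta(x)^{p/2}\rho_\delta(x')^{p/2},$$ and let $u\in W^{1,2}_0(\Omega)$ be the solution of $\int_\Omega\rho^p\,\nabla u\cdot\nabla v\,dx=\ell(v)$ for all $v\in W^{1,2}_0(\Omega)$. Write $\mathfrak c_\delta(\rho_\delta)=\ell(u_\delta)$ and $\mathfrak c(\rho)=\ell(u)$ for the nonlocal and the local compliance. Then $$\liminf_{\delta\to0}\mathfrak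 c_\delta(\rho_\delta)\ge\mathfrak c(\rho).$$ Here $\delta\to0$ may be understood along all $\delta\downarrow0$, or along any given sequence of positive numbers $\delta_j\to 0$ or, more generally, any filter on $\mathbb R$ finer than that of right neighbourhoods of $0$ (the same one in the hypothesis and in the conclusion). -/

import Mathlib

open MeasureTheory Set Filter Topology
open scoped ContDiff ENNReal InnerProductSpace

noncomputable section

namespace NonlocalSIMP

/-- `φ ∈ C_c^∞(Ω)`, extended by zero to the whole space. -/
structure IsTestFunction {n : ℕ} (Ω : Set (EuclideanSpace ℝ (Fin n)))
    (φ : EuclideanSpace ℝ (Fin n) → ℝ) : Prop where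
  smooth : ContDiff ℝ ∞ φ
  compact : HasCompactSupport φ
  supp : tsupport φ ⊆ Ω

/-- `G` is the weak gradient of `u` in `Ω`. -/
def HasWeakGradient {n : ℕ} (Ω : Set (EuclideanSpace ℝ (Fin n)))
    (u : EuclideanSpace ℝ (Fin n) → ℝ)
    (G : EuclideanSpace ℝ (Fin n) → EuclideanSpace ℝ (Fin n)) : Prop :=
  ∀ φ, IsTestFunction Ω φ →
    ∫ x in Ω, u x • gradient φ x = -∫ x in Ω, φ x • G x

/-- `u ∈ W^{1,2}_0(Ω)` with weak gradient `G`: both are square integrable in `Ω`, and `u` is in the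
closure of `C_c^∞(Ω)` for the `W^{1,2}(Ω)` norm. -/
structure MemW0 {n : ℕ} (Ω : Set (EuclideanSpace ℝ (Fin n)))
    (u : EuclideanSpace ℝ (Fin n) → ℝ)
    (G : EuclideanSpace ℝ (Fin n) → EuclideanSpace ℝ (Fin n)) : Prop where
  memLp : MemLp u 2 (volume.restrict Ω)
  memLp_grad : MemLp G 2 (volume.restrict Ω)
  weakGradient : HasWeakGradient Ω u G
  closure : ∀ ε : ℝ, 0 < ε → ∃ φ, IsTestFunction Ω φ ∧
    eLpNorm (fun x => u x - φ x) 2 (volume.restrict Ω) +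
      eLpNorm (fun x => G x - gradient φ x) 2 (volume.restrict Ω) < ENNReal.ofReal ε

/-- The load functional `ℓ(v) = ∫_Ω f v`. When `v` is the state that corresponds to a material
distribution, `ℓ(v)` is the compliance of this distribution. -/
def load {n : ℕ} (Ω : Set (EuclideanSpace ℝ (Fin n)))
    (f v : EuclideanSpace ℝ (Fin n) → ℝ) : ℝ :=
  ∫ x in Ω, f x * v x

/-- `u ∈ W^{1,2}_0(Ω)` is a weak solution of `-div (k ∇u) = f` with zero Dirichlet data:
`∫_Ω k ∇u · ∇v = ℓ(v)` for all `v ∈ W^{1,2}_0(Ω)`. -/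
def IsLocalState {n : ℕ} (Ω : Set (EuclideanSpace ℝ (Fin n)))
    (f k u : EuclideanSpace ℝ (Fin n) → ℝ) : Prop :=
  ∃ G, MemW0 Ω u G ∧
    ∀ v H, MemW0 Ω v H → ∫ x in Ω, k x * ⟪G x, H x⟫_ℝ = load Ω f v

/-- The assumptions on the family of radial kernels `A δ : ℝ₊ → ℝ₊`, `δ > 0`. As `n ≠ 0` in all
uses, `normalized` contains the integrability of `A δ ‖·‖`, hence its measurability. -/
structure IsAdmissibleKernel (n : ℕ) (A : ℝ → ℝ → ℝ) : Prop where
  nonneg : ∀ δ, 0 < δ → ∀ r, 0 ≤ r → 0 ≤ A δ r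
  normalized : ∀ δ, 0 < δ →
    (1 / (n : ℝ)) * ∫ x : EuclideanSpace ℝ (Fin n), A δ ‖x‖ = 1
  supp : ∀ δ, 0 < δ →
    Function.support (fun x : EuclideanSpace ℝ (Fin n) => A δ ‖x‖) ⊆ Metric.ball 0 δ
  lower_bound : ∃ s : ℝ, s ∈ Ioo (0 : ℝ) 1 ∧ ∀ δ, 0 < δ → ∃ c : ℝ, 0 < c ∧
    ∀ x : EuclideanSpace ℝ (Fin n), x ∈ Metric.ball 0 (δ / 2) → x ≠ 0 →
      c / ‖x‖ ^ ((n : ℝ) + 2 * s - 2) ≤ A δ ‖x‖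

/-- The integrand of the nonlocal bilinear form, at `z = (x, x')`. -/
def nonlocalDensity {n : ℕ} (a : ℝ → ℝ)
    (κ : EuclideanSpace ℝ (Fin n) → EuclideanSpace ℝ (Fin n) → ℝ)
    (u v : EuclideanSpace ℝ (Fin n) → ℝ)
    (z : EuclideanSpace ℝ (Fin n) × EuclideanSpace ℝ (Fin n)) : ℝ :=
  κ z.1 z.2 * a ‖z.1 - z.2‖ * ((u z.1 - u z.2) / ‖z.1 - z.2‖) *
    ((v z.1 - v z.2) / ‖z.1 - z.2‖)

/-- The nonlocal bilinear form `a_{δ,κ}(u,v)`, an integral over `Ω_δ × Ω_δ`, where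
`Ω_δ = ⋃_{x ∈ Ω} B(x,δ)` is `Metric.thickening δ Ω`. -/
def nonlocalForm {n : ℕ} (Ω : Set (EuclideanSpace ℝ (Fin n))) (A : ℝ → ℝ → ℝ) (δ : ℝ)
    (κ : EuclideanSpace ℝ (Fin n) → EuclideanSpace ℝ (Fin n) → ℝ)
    (u v : EuclideanSpace ℝ (Fin n) → ℝ) : ℝ :=
  ∫ z in Metric.thickening δ Ω ×ˢ Metric.thickening δ Ω, nonlocalDensity (A δ) κ u v z

/-- The space `{u ∈ L²(Ω_δ) : a_{δ,1}(u,u) < ∞}`. -/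
structure MemU {n : ℕ} (Ω : Set (EuclideanSpace ℝ (Fin n))) (A : ℝ → ℝ → ℝ) (δ : ℝ)
    (u : EuclideanSpace ℝ (Fin n) → ℝ) : Prop where
  memLp : MemLp u 2 (volume.restrict (Metric.thickening δ Ω))
  finite_energy : IntegrableOn (nonlocalDensity (A δ) (fun _ _ => 1) u u)
    (Metric.thickening δ Ω ×ˢ Metric.thickening δ Ω)

/-- The closure of `C_c^∞(Ω)` for the energy `a_{δ,1}`, among the functions of finite energy that
vanish on the nonlocal boundary `Ω_δ \ Ω`. The condition on the nonlocal boundary excludes the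
nonzero constants, on which `a_{δ,1}` vanishes. -/
structure MemU0 {n : ℕ} (Ω : Set (EuclideanSpace ℝ (Fin n))) (A : ℝ → ℝ → ℝ) (δ : ℝ)
    (u : EuclideanSpace ℝ (Fin n) → ℝ) : Prop where
  memU : MemU Ω A δ u
  vanish : ∀ᵐ x ∂(volume.restrict (Metric.thickening δ Ω \ Ω)), u x = 0
  closure : ∀ ε : ℝ, 0 < ε → ∃ φ, IsTestFunction Ω φ ∧
    nonlocalForm Ω A δ (fun _ _ => 1) (fun x => u x - φ x) (fun x => u x - φ x) < ε

/-- `u` solves the nonlocal state equation `a_{δ,κ}(u,v) = ℓ(v)` for all `v`. -/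
def IsNonlocalState {n : ℕ} (Ω : Set (EuclideanSpace ℝ (Fin n)))
    (f : EuclideanSpace ℝ (Fin n) → ℝ) (A : ℝ → ℝ → ℝ) (δ : ℝ)
    (κ : EuclideanSpace ℝ (Fin n) → EuclideanSpace ℝ (Fin n) → ℝ)
    (u : EuclideanSpace ℝ (Fin n) → ℝ) : Prop :=
  MemU0 Ω A δ u ∧ ∀ v, MemU0 Ω A δ v → nonlocalForm Ω A δ κ u v = load Ω f v

/-- The geometric mean of the local SIMP conductivities `ρ^p` at `x` and `x'`. -/
def simpConductivity {n : ℕ} (p : ℝ) (ρ : EuclideanSpace ℝ (Fin n) → ℝ)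
    (x x' : EuclideanSpace ℝ (Fin n)) : ℝ :=
  ρ x ^ (p / 2) * ρ x' ^ (p / 2)

/-- Weak* convergence in `L^∞(D)` along `l`: convergence against every function in `L¹(D)`. -/
def WeakStarTendsto {n : ℕ} (D : Set (EuclideanSpace ℝ (Fin n))) {ι : Type*}
    (h : ι → EuclideanSpace ℝ (Fin n) → ℝ) (l : Filter ι)
    (h' : EuclideanSpace ℝ (Fin n) → ℝ) : Prop :=
  ∀ g : EuclideanSpace ℝ (Fin n) → ℝ, IntegrableOn g D →
    Tendsto (fun i => ∫ x in D, h i x * g x) l (𝓝 (∫ x in D, h' x * g x))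

end NonlocalSIMP

end

/-!
The bound is the easy half of a Γ-convergence argument and needs neither compactness nor a nonlocal
Poincaré inequality, because the compliance is a maximum: since `u_δ` solves the state equation,
`ℓ(u_δ) ≥ 2 ℓ(φ) - a_{δ,κ_δ}(φ,φ)` for every test function `φ`
(`IsNonlocalState.two_mul_load_sub_le`, from `a_{δ,κ_δ}(u_δ - φ, u_δ - φ) ≥ 0`). It remains to bound
`a_{δ,κ_δ}(φ,φ)` from above for a fixed `φ`.

* By the arithmetic-geometric mean inequality `κ_δ(x,x') ≤ (ρ_δ(x)^p + ρ_δ(x')^p) / 2`, and by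
  symmetry the right-hand side can be replaced by `ρ_δ(x)^p` under the integral
  (`setIntegral_simpConductivity_mul_le`). The energy density is now linear in `ρ_δ^p`, the quantity
  that converges weakly*.
* By Taylor's formula and the isotropy of radial kernels (`integral_radial_mul_inner_sq`), the
  integral in `x'` of the difference quotients of `φ` is at most `‖∇φ(x)‖² + O(δ)`, uniformly in `x`
  (`setIntegral_nonlocalDensity_le`).

Hence `a_{δ,κ_δ}(φ,φ) ≤ ∫ ρ_δ^p ‖∇φ‖² + O(δ)` (`nonlocalForm_simpConductivity_le`), and weak*
convergence yields `liminf ℓ(u_δ) ≥ 2 ℓ(φ) - ∫_Ω ρ^p ‖∇φ‖²`. The supremum of the right-hand side over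
all `φ` is `ℓ(u)`, as test functions are dense in `W^{1,2}_0(Ω)`
(`IsLocalState.exists_isTestFunction_lt`).
-/

namespace NonlocalSIMP

variable {n : ℕ}

/-! ### Test functions -/

theorem IsTestFunction.differentiable {Ω : Set (EuclideanSpace ℝ (Fin n))}
    {φ : EuclideanSpace ℝ (Fin n) → ℝ} (hφ : IsTestFunction Ω φ) : Differentiable ℝ φ :=
  hφ.smooth.differentiable (by simp)

theorem IsTestFunction.continuous_gradient {Ω : Set (EuclideanSpace ℝ (Fin n))}
    {φ : EuclideanSpace ℝ (Fin n) → ℝ} (hφ : IsTestFunction Ω φ) : Continuous (gradient φ) :=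
  (InnerProductSpace.toDual ℝ (EuclideanSpace ℝ (Fin n))).symm.continuous.comp
    (hφ.smooth.continuous_fderiv (by simp))

theorem IsTestFunction.hasCompactSupport_gradient {Ω : Set (EuclideanSpace ℝ (Fin n))}
    {φ : EuclideanSpace ℝ (Fin n) → ℝ} (hφ : IsTestFunction Ω φ) :
    HasCompactSupport (gradient φ) :=
  (hφ.compact.fderiv (𝕜 := ℝ)).comp_left (map_zero _)

theorem IsTestFunction.gradient_eq_zero {Ω : Set (EuclideanSpace ℝ (Fin n))}
    {φ : EuclideanSpace ℝ (Fin n) → ℝ} (hφ : IsTestFunction Ω φ)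
    {x : EuclideanSpace ℝ (Fin n)} (hx : x ∉ Ω) : gradient φ x = 0 := by
  have h : fderiv ℝ φ x = 0 :=
    image_eq_zero_of_notMem_tsupport fun h => hx (hφ.supp (tsupport_fderiv_subset ℝ h))
  simp [gradient, h]

theorem IsTestFunction.exists_lipschitz {Ω : Set (EuclideanSpace ℝ (Fin n))}
    {φ : EuclideanSpace ℝ (Fin n) → ℝ} (hφ : IsTestFunction Ω φ) :
    ∃ L : ℝ, 0 ≤ L ∧ ∀ x y, |φ x - φ y| ≤ L * ‖x - y‖ := by
  obtain ⟨L, hL⟩ := hφ.smooth.lipschitzWith_of_hasCompactSupport hφ.compact (by simp)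
  exact ⟨L, L.2, fun x y => by simpa [dist_eq_norm] using hL.dist_le_mul x y⟩

/-- Squared difference quotients of a test function are, uniformly in space, at most first order
in the distance away from the squared directional derivatives. -/
theorem IsTestFunction.exists_sq_sub_le {Ω : Set (EuclideanSpace ℝ (Fin n))}
    {φ : EuclideanSpace ℝ (Fin n) → ℝ} (hφ : IsTestFunction Ω φ) :
    ∃ C : ℝ, 0 ≤ C ∧ ∀ x y,
      (φ x - φ y) ^ 2 ≤ ⟪gradient φ x, x - y⟫_ℝ ^ 2 + C * ‖x - y‖ ^ 3 := by
  obtain ⟨L, hL⟩ := hφ.smooth.lipschitzWith_of_hasCompactSupport hφ.compact (by simp)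
  have hsm : ContDiff ℝ 1 (fderiv ℝ φ) :=
    (contDiff_infty_iff_fderiv.1 hφ.smooth).2.of_le (by simp)
  obtain ⟨M, hM⟩ := hsm.lipschitzWith_of_hasCompactSupport (hφ.compact.fderiv (𝕜 := ℝ)) (by simp)
  refine ⟨M * (2 * L), by positivity, fun x y => ?_⟩
  have h1 : |φ x - φ y| ≤ L * ‖x - y‖ := by simpa [dist_eq_norm] using hL.dist_le_mul x y
  have h2 : |⟪gradient φ x, x - y⟫_ℝ| ≤ L * ‖x - y‖ := by
    rw [inner_gradient_left, ← Real.norm_eq_abs]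
    exact (fderiv ℝ φ x).le_of_opNorm_le (norm_fderiv_le_of_lipschitz ℝ hL) _
  have h3 : |φ x - φ y - ⟪gradient φ x, x - y⟫_ℝ| ≤ M * ‖x - y‖ * ‖x - y‖ := by
    have := (convex_closedBall x ‖x - y‖).norm_image_sub_le_of_norm_fderiv_le'
      (f := φ) (φ := fderiv ℝ φ x) (C := M * ‖x - y‖) (x := y) (y := x)
      (fun z _ => hφ.differentiable z)
      (fun z hz => by
        have hzx : dist z x ≤ ‖x - y‖ := hz
        have := hM.dist_le_mul z x
        rw [dist_eq_norm] at this
        exact this.trans (by gcongr))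
      (by simp [dist_eq_norm, norm_sub_rev]) (by simp)
    rw [inner_gradient_left]
    simpa using this
  have h4 : |φ x - φ y + ⟪gradient φ x, x - y⟫_ℝ| ≤ 2 * L * ‖x - y‖ :=
    (abs_add_le _ _).trans (by linarith)
  have h5 := mul_le_mul h3 h4 (abs_nonneg _) (by positivity)
  rw [← abs_mul] at h5
  have h6 := (le_abs_self _).trans h5
  linarith

/-! ### Radial kernels -/

/-- A radial weight averages the squared directional derivatives isotropically: this is the reason
for the factor `1 / n` in the normalization of the kernels. -/
theorem integral_radial_mul_inner_sq {a : ℝ → ℝ}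
    (ha : Integrable fun z : EuclideanSpace ℝ (Fin n) => a ‖z‖)
    (ξ : EuclideanSpace ℝ (Fin n)) :
    Integrable (fun z : EuclideanSpace ℝ (Fin n) => a ‖z‖ * (⟪ξ, z⟫_ℝ / ‖z‖) ^ 2) ∧
    n * ∫ z : EuclideanSpace ℝ (Fin n), a ‖z‖ * (⟪ξ, z⟫_ℝ / ‖z‖) ^ 2 =
      ‖ξ‖ ^ 2 * ∫ z : EuclideanSpace ℝ (Fin n), a ‖z‖ := by
  have hint : ∀ η : EuclideanSpace ℝ (Fin n),
      Integrable (fun z : EuclideanSpace ℝ (Fin n) => a ‖z‖ * (⟪η, z⟫_ℝ / ‖z‖) ^ 2) := fun η => by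
    refine ha.mul_bdd (c := ‖η‖ ^ 2) ?_ (ae_of_all _ fun z => ?_)
    · exact Measurable.aestronglyMeasurable (by fun_prop)
    · rw [norm_pow, norm_div, norm_norm]
      gcongr
      exact div_le_of_le_mul₀ (norm_nonneg _) (norm_nonneg _) (norm_inner_le_norm _ _)
  refine ⟨hint ξ, ?_⟩
  -- A reflection carries any vector to any other one of the same length.
  have hinv : ∀ η ζ : EuclideanSpace ℝ (Fin n), ‖η‖ = ‖ζ‖ →
      ∫ z : EuclideanSpace ℝ (Fin n), a ‖z‖ * (⟪η, z⟫_ℝ / ‖z‖) ^ 2 =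
        ∫ z : EuclideanSpace ℝ (Fin n), a ‖z‖ * (⟪ζ, z⟫_ℝ / ‖z‖) ^ 2 := fun η ζ h => by
    set R := (ℝ ∙ (η - ζ))ᗮ.reflection
    have hR : R η = ζ := Submodule.reflection_sub h
    rw [← R.measurePreserving.integral_comp R.toHomeomorph.measurableEmbedding
      fun z => a ‖z‖ * (⟪ζ, z⟫_ℝ / ‖z‖) ^ 2]
    simp only [← hR, LinearIsometryEquiv.norm_map, LinearIsometryEquiv.inner_map_map]
  have hsum : ∑ i : Fin n, ∫ z : EuclideanSpace ℝ (Fin n),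
      a ‖z‖ * (⟪‖ξ‖ • EuclideanSpace.single i (1 : ℝ), z⟫_ℝ / ‖z‖) ^ 2 =
        ‖ξ‖ ^ 2 * ∫ z : EuclideanSpace ℝ (Fin n), a ‖z‖ := by
    rw [← integral_finsetSum _ fun i _ => hint _, ← integral_const_mul]
    rcases Nat.eq_zero_or_pos n with rfl | hn
    · simp [Subsingleton.elim ξ 0]
    have : Nonempty (Fin n) := ⟨⟨0, hn⟩⟩
    refine integral_congr_ae ?_
    -- The sum of the squared quotients is `‖ξ‖ ^ 2` except at `z = 0`, where they are `0 / 0 = 0`.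
    filter_upwards [compl_mem_ae_iff.2 (measure_singleton (0 : EuclideanSpace ℝ (Fin n)))]
      with z hz
    have hz : ‖z‖ ≠ 0 := norm_ne_zero_iff.2 hz
    have hsq : ∑ i, z i ^ 2 = ‖z‖ ^ 2 := by simp [EuclideanSpace.norm_sq_eq]
    simp only [inner_smul_left, EuclideanSpace.inner_single_left, div_pow, mul_pow, conj_trivial,
      one_mul, map_one]
    rw [← Finset.mul_sum, ← Finset.sum_div, ← Finset.mul_sum, hsq]
    field_simp
  rw [← hsum, Finset.sum_congr rfl fun i _ => hinv _ ξ (by simp [norm_smul])]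
  simp

/-- The kernel as a function of two points is integrable over pairs from a set of finite measure:
it is the integrand of a convolution with the indicator of the set. -/
theorem integrableOn_kernel_sub {a : ℝ → ℝ}
    (ha : Integrable fun z : EuclideanSpace ℝ (Fin n) => a ‖z‖)
    {S : Set (EuclideanSpace ℝ (Fin n))} (hS : MeasurableSet S) (hSfin : volume S ≠ ⊤) :
    IntegrableOn (fun z : EuclideanSpace ℝ (Fin n) × EuclideanSpace ℝ (Fin n) =>
      a ‖z.1 - z.2‖) (S ×ˢ S) := by
  have h1 : Integrable (S.indicator fun _ : EuclideanSpace ℝ (Fin n) => (1 : ℝ)) :=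
    (integrable_indicator_iff hS).2 (integrableOn_const hSfin)
  have h2 := h1.convolution_integrand (ContinuousLinearMap.mul ℝ ℝ) ha
  refine (integrableOn_congr_fun ?_ (hS.prod hS)).1 h2.integrableOn
  rintro ⟨x, y⟩ ⟨_, hy⟩
  have hy : y ∈ S := hy
  simp [hy]

/-! ### Nonlocal energies -/

theorem nonlocalDensity_eq_mul (a : ℝ → ℝ)
    (κ : EuclideanSpace ℝ (Fin n) → EuclideanSpace ℝ (Fin n) → ℝ)
    (u v : EuclideanSpace ℝ (Fin n) → ℝ)
    (z : EuclideanSpace ℝ (Fin n) × EuclideanSpace ℝ (Fin n)) :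
    nonlocalDensity a κ u v z = κ z.1 z.2 * nonlocalDensity a (fun _ _ => 1) u v z := by
  simp only [nonlocalDensity]
  ring

theorem nonlocalDensity_self_nonneg {a : ℝ → ℝ} (ha0 : ∀ r, 0 ≤ r → 0 ≤ a r)
    (u : EuclideanSpace ℝ (Fin n) → ℝ)
    (z : EuclideanSpace ℝ (Fin n) × EuclideanSpace ℝ (Fin n)) :
    0 ≤ nonlocalDensity a (fun _ _ => 1) u u z := by
  have := mul_nonneg (ha0 _ (norm_nonneg (z.1 - z.2)))
    (mul_self_nonneg ((u z.1 - u z.2) / ‖z.1 - z.2‖))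
  simp only [nonlocalDensity]
  linarith

/-- Young's inequality for the nonlocal density. -/
theorem two_mul_abs_nonlocalDensity_le {a : ℝ → ℝ} (ha0 : ∀ r, 0 ≤ r → 0 ≤ a r)
    (u v : EuclideanSpace ℝ (Fin n) → ℝ)
    (z : EuclideanSpace ℝ (Fin n) × EuclideanSpace ℝ (Fin n)) :
    2 * |nonlocalDensity a (fun _ _ => 1) u v z| ≤
      nonlocalDensity a (fun _ _ => 1) u u z + nonlocalDensity a (fun _ _ => 1) v v z := by
  have h := ha0 _ (norm_nonneg (z.1 - z.2))
  simp only [nonlocalDensity, one_mul]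
  rw [mul_assoc, abs_mul, abs_of_nonneg h, mul_assoc, mul_assoc, ← mul_add, mul_left_comm]
  gcongr
  rw [abs_mul, ← abs_mul_abs_self ((u z.1 - u z.2) / ‖z.1 - z.2‖),
    ← abs_mul_abs_self ((v z.1 - v z.2) / ‖z.1 - z.2‖)]
  nlinarith [sq_nonneg (|(u z.1 - u z.2) / ‖z.1 - z.2‖| - |(v z.1 - v z.2) / ‖z.1 - z.2‖|)]

theorem ae_prod_of_ae {S : Set (EuclideanSpace ℝ (Fin n))} {P : EuclideanSpace ℝ (Fin n) → Prop}
    (h : ∀ᵐ x ∂(volume.restrict S), P x) :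
    ∀ᵐ z : EuclideanSpace ℝ (Fin n) × EuclideanSpace ℝ (Fin n) ∂(volume.restrict (S ×ˢ S)),
      P z.1 ∧ P z.2 := by
  rw [Measure.volume_eq_prod, ← Measure.prod_restrict]
  exact (Measure.quasiMeasurePreserving_fst.ae h).and (Measure.quasiMeasurePreserving_snd.ae h)

theorem aestronglyMeasurable_prod_fst_snd {S : Set (EuclideanSpace ℝ (Fin n))}
    {u : EuclideanSpace ℝ (Fin n) → ℝ} (hu : AEStronglyMeasurable u (volume.restrict S)) :
    AEStronglyMeasurable (fun z : EuclideanSpace ℝ (Fin n) × EuclideanSpace ℝ (Fin n) => u z.1)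
      (volume.restrict (S ×ˢ S)) ∧
    AEStronglyMeasurable (fun z : EuclideanSpace ℝ (Fin n) × EuclideanSpace ℝ (Fin n) => u z.2)
      (volume.restrict (S ×ˢ S)) := by
  rw [Measure.volume_eq_prod, ← Measure.prod_restrict]
  exact ⟨hu.comp_fst, hu.comp_snd⟩

theorem aestronglyMeasurable_nonlocalDensity {a : ℝ → ℝ}
    (ha : Integrable fun z : EuclideanSpace ℝ (Fin n) => a ‖z‖)
    {S : Set (EuclideanSpace ℝ (Fin n))} (hS : MeasurableSet S) (hSfin : volume S ≠ ⊤)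
    {u v : EuclideanSpace ℝ (Fin n) → ℝ}
    (hu : AEStronglyMeasurable u (volume.restrict S))
    (hv : AEStronglyMeasurable v (volume.restrict S)) :
    AEStronglyMeasurable (nonlocalDensity a (fun _ _ => 1) u v) (volume.restrict (S ×ˢ S)) := by
  have hk := (integrableOn_kernel_sub ha hS hSfin).aestronglyMeasurable
  obtain ⟨hu1, hu2⟩ := aestronglyMeasurable_prod_fst_snd hu
  obtain ⟨hv1, hv2⟩ := aestronglyMeasurable_prod_fst_snd hv
  have hn : AEMeasurable (fun z : EuclideanSpace ℝ (Fin n) × EuclideanSpace ℝ (Fin n) =>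
      ‖z.1 - z.2‖) (volume.restrict (S ×ˢ S)) := by fun_prop
  have hu' := ((hu1.sub hu2).aemeasurable.div hn).aestronglyMeasurable
  have hv' := ((hv1.sub hv2).aemeasurable.div hn).aestronglyMeasurable
  exact ((aestronglyMeasurable_const (b := (1 : ℝ))).mul hk |>.mul hu').mul hv'

theorem integrableOn_nonlocalDensity {a : ℝ → ℝ}
    (ha : Integrable fun z : EuclideanSpace ℝ (Fin n) => a ‖z‖)
    (ha0 : ∀ r, 0 ≤ r → 0 ≤ a r)
    {S : Set (EuclideanSpace ℝ (Fin n))} (hS : MeasurableSet S) (hSfin : volume S ≠ ⊤)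
    {u v : EuclideanSpace ℝ (Fin n) → ℝ}
    (hu : AEStronglyMeasurable u (volume.restrict S))
    (hv : AEStronglyMeasurable v (volume.restrict S))
    (huu : IntegrableOn (nonlocalDensity a (fun _ _ => 1) u u) (S ×ˢ S))
    (hvv : IntegrableOn (nonlocalDensity a (fun _ _ => 1) v v) (S ×ˢ S)) :
    IntegrableOn (nonlocalDensity a (fun _ _ => 1) u v) (S ×ˢ S) :=
  (huu.add hvv).mono' (aestronglyMeasurable_nonlocalDensity ha hS hSfin hu hv)
    (ae_of_all _ fun z => by
      have h1 := two_mul_abs_nonlocalDensity_le ha0 u v z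
      have h2 := abs_nonneg (nonlocalDensity a (fun _ _ => 1) u v z)
      simp only [Real.norm_eq_abs, Pi.add_apply]
      linarith)

/-- Test functions have finite energy, by Lipschitz continuity. -/
theorem IsTestFunction.integrableOn_nonlocalDensity {Ω : Set (EuclideanSpace ℝ (Fin n))}
    {φ : EuclideanSpace ℝ (Fin n) → ℝ} (hφ : IsTestFunction Ω φ) {a : ℝ → ℝ}
    (ha : Integrable fun z : EuclideanSpace ℝ (Fin n) => a ‖z‖)
    (ha0 : ∀ r, 0 ≤ r → 0 ≤ a r)
    {S : Set (EuclideanSpace ℝ (Fin n))} (hS : MeasurableSet S) (hSfin : volume S ≠ ⊤) :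
    IntegrableOn (nonlocalDensity a (fun _ _ => 1) φ φ) (S ×ˢ S) := by
  obtain ⟨L, hL0, hL⟩ := hφ.exists_lipschitz
  have hφm : AEStronglyMeasurable φ (volume.restrict S) :=
    hφ.smooth.continuous.aestronglyMeasurable
  refine ((integrableOn_kernel_sub ha hS hSfin).mul_const (L * L)).mono'
    (aestronglyMeasurable_nonlocalDensity ha hS hSfin hφm hφm) (ae_of_all _ fun z => ?_)
  rw [Real.norm_of_nonneg (nonlocalDensity_self_nonneg ha0 φ z)]
  have h := ha0 _ (norm_nonneg (z.1 - z.2))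
  simp only [nonlocalDensity, one_mul]
  rw [mul_assoc, ← abs_mul_abs_self, abs_div, abs_norm]
  have h1 : |φ z.1 - φ z.2| / ‖z.1 - z.2‖ ≤ L :=
    div_le_of_le_mul₀ (norm_nonneg _) hL0 (hL _ _)
  gcongr

theorem IsTestFunction.memU0 {Ω : Set (EuclideanSpace ℝ (Fin n))} (hΩ : MeasurableSet Ω)
    {φ : EuclideanSpace ℝ (Fin n) → ℝ} (hφ : IsTestFunction Ω φ) {A : ℝ → ℝ → ℝ} {δ : ℝ}
    (ha : Integrable fun z : EuclideanSpace ℝ (Fin n) => A δ ‖z‖)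
    (ha0 : ∀ r, 0 ≤ r → 0 ≤ A δ r) (hSfin : volume (Metric.thickening δ Ω) ≠ ⊤) :
    MemU0 Ω A δ φ where
  memU := ⟨(hφ.smooth.continuous.memLp_of_hasCompactSupport hφ.compact).restrict _,
    hφ.integrableOn_nonlocalDensity ha ha0 Metric.isOpen_thickening.measurableSet hSfin⟩
  vanish := by
    refine (ae_restrict_iff' (Metric.isOpen_thickening.measurableSet.diff hΩ)).2
      (ae_of_all _ fun x hx => ?_)
    exact image_eq_zero_of_notMem_tsupport fun h => hx.2 (hφ.supp h)
  closure ε hε := ⟨φ, hφ, by simpa [nonlocalForm, nonlocalDensity] using hε⟩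

/-! ### The SIMP conductivity -/

theorem rpow_half_mul_self {t : ℝ} (ht : 0 ≤ t) (p : ℝ) : t ^ (p / 2) * t ^ (p / 2) = t ^ p := by
  rw [← sq, ← Real.rpow_mul_natCast ht]
  norm_num

theorem simpConductivity_nonneg {p : ℝ} {ρ : EuclideanSpace ℝ (Fin n) → ℝ}
    {x y : EuclideanSpace ℝ (Fin n)} (hx : 0 ≤ ρ x) (hy : 0 ≤ ρ y) :
    0 ≤ simpConductivity p ρ x y :=
  mul_nonneg (Real.rpow_nonneg hx _) (Real.rpow_nonneg hy _)

/-- The inequality of the geometric and the arithmetic mean. -/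
theorem simpConductivity_le {p : ℝ} {ρ : EuclideanSpace ℝ (Fin n) → ℝ}
    {x y : EuclideanSpace ℝ (Fin n)} (hx : 0 ≤ ρ x) (hy : 0 ≤ ρ y) :
    simpConductivity p ρ x y ≤ (ρ x ^ p + ρ y ^ p) / 2 := by
  rw [← rpow_half_mul_self hx, ← rpow_half_mul_self hy, simpConductivity]
  nlinarith [sq_nonneg (ρ x ^ (p / 2) - ρ y ^ (p / 2))]

theorem _root_.MeasureTheory.IntegrableOn.simpConductivity_mul {p ρmin ρmax : ℝ}
    (hp : 0 ≤ p) (hρmin : 0 ≤ ρmin)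
    {ρ : EuclideanSpace ℝ (Fin n) → ℝ} {S : Set (EuclideanSpace ℝ (Fin n))}
    (hρm : AEStronglyMeasurable ρ (volume.restrict S))
    (hρ : ∀ᵐ x ∂(volume.restrict S), ρ x ∈ Icc ρmin ρmax)
    {g : EuclideanSpace ℝ (Fin n) × EuclideanSpace ℝ (Fin n) → ℝ} (hg : IntegrableOn g (S ×ˢ S)) :
    IntegrableOn (fun z => simpConductivity p ρ z.1 z.2 * g z) (S ×ˢ S) := by
  have hm : AEStronglyMeasurable (fun x => ρ x ^ (p / 2)) (volume.restrict S) :=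
    (hρm.aemeasurable.pow_const _).aestronglyMeasurable
  obtain ⟨h1, h2⟩ := aestronglyMeasurable_prod_fst_snd hm
  refine Integrable.bdd_mul (c := (ρmax ^ p + ρmax ^ p) / 2) hg (h1.mul h2) ?_
  filter_upwards [ae_prod_of_ae hρ] with z hz
  have hz1 := hρmin.trans hz.1.1
  have hz2 := hρmin.trans hz.2.1
  rw [Real.norm_of_nonneg (simpConductivity_nonneg hz1 hz2)]
  have e1 := Real.rpow_le_rpow hz1 hz.1.2 hp
  have e2 := Real.rpow_le_rpow hz2 hz.2.2 hp
  linarith [simpConductivity_le (p := p) hz1 hz2]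

/-! ### Nonlocal compliance and energies of test functions -/

/-- The dual (maximum) characterization of the compliance, tested with `φ`. -/
theorem IsNonlocalState.two_mul_load_sub_le {Ω : Set (EuclideanSpace ℝ (Fin n))}
    (hΩ : MeasurableSet Ω) {f : EuclideanSpace ℝ (Fin n) → ℝ} {A : ℝ → ℝ → ℝ} {δ : ℝ}
    (ha : Integrable fun z : EuclideanSpace ℝ (Fin n) => A δ ‖z‖)
    (ha0 : ∀ r, 0 ≤ r → 0 ≤ A δ r) (hSfin : volume (Metric.thickening δ Ω) ≠ ⊤)
    {p ρmin ρmax : ℝ} (hp : 0 ≤ p) (hρmin : 0 ≤ ρmin) {ρ : EuclideanSpace ℝ (Fin n) → ℝ}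
    (hρm : AEStronglyMeasurable ρ (volume.restrict (Metric.thickening δ Ω)))
    (hρ : ∀ᵐ x ∂(volume.restrict (Metric.thickening δ Ω)), ρ x ∈ Icc ρmin ρmax)
    {u φ : EuclideanSpace ℝ (Fin n) → ℝ}
    (hu : IsNonlocalState Ω f A δ (simpConductivity p ρ) u) (hφ : IsTestFunction Ω φ) :
    2 * load Ω f φ - nonlocalForm Ω A δ (simpConductivity p ρ) φ φ ≤ load Ω f u := by
  have hS : MeasurableSet (Metric.thickening δ Ω) := Metric.isOpen_thickening.measurableSet
  have hφU := hφ.memU0 hΩ ha ha0 hSfin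
  have huu := hu.1.memU.finite_energy
  have hφφ := hφU.memU.finite_energy
  have huφ := integrableOn_nonlocalDensity ha ha0 hS hSfin hu.1.memU.memLp.1
    hφU.memU.memLp.1 huu hφφ
  have key : 2 * nonlocalForm Ω A δ (simpConductivity p ρ) u φ ≤
      nonlocalForm Ω A δ (simpConductivity p ρ) u u +
        nonlocalForm Ω A δ (simpConductivity p ρ) φ φ := by
    have Iuu := huu.simpConductivity_mul hp hρmin hρm hρ
    have Iuφ := huφ.simpConductivity_mul hp hρmin hρm hρ
    have Iφφ := hφφ.simpConductivity_mul hp hρmin hρm hρ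
    simp only [nonlocalForm]
    rw [integral_congr_ae (ae_of_all _ (nonlocalDensity_eq_mul (A δ) (simpConductivity p ρ) u φ)),
      integral_congr_ae (ae_of_all _ (nonlocalDensity_eq_mul (A δ) (simpConductivity p ρ) u u)),
      integral_congr_ae (ae_of_all _ (nonlocalDensity_eq_mul (A δ) (simpConductivity p ρ) φ φ)),
      ← integral_add Iuu Iφφ, ← integral_const_mul]
    refine integral_mono_ae (Iuφ.const_mul 2) (Iuu.add Iφφ) ?_
    filter_upwards [ae_prod_of_ae hρ] with z hz
    have h1 := simpConductivity_nonneg (p := p) (hρmin.trans hz.1.1) (hρmin.trans hz.2.1)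
    have h2 := two_mul_abs_nonlocalDensity_le ha0 u φ z
    have h3 := le_abs_self (nonlocalDensity (A δ) (fun _ _ => 1) u φ z)
    rw [mul_left_comm, ← mul_add]
    exact mul_le_mul_of_nonneg_left (by linarith) h1
  rw [hu.2 φ hφU, hu.2 u hu.1] at key
  linarith

/-- At each point, the nonlocal energy density of a test function exceeds the local one `‖∇φ‖²` by
at most a multiple of `δ`. -/
theorem setIntegral_nonlocalDensity_le {φ : EuclideanSpace ℝ (Fin n) → ℝ} {C : ℝ} (hC : 0 ≤ C)
    (hφ : ∀ x y, (φ x - φ y) ^ 2 ≤ ⟪gradient φ x, x - y⟫_ℝ ^ 2 + C * ‖x - y‖ ^ 3)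
    (hn : n ≠ 0) {a : ℝ → ℝ} {δ : ℝ}
    (ha : Integrable fun z : EuclideanSpace ℝ (Fin n) => a ‖z‖)
    (ha0 : ∀ r, 0 ≤ r → 0 ≤ a r)
    (ha1 : ∫ z : EuclideanSpace ℝ (Fin n), a ‖z‖ = n)
    (hsupp : Function.support (fun z : EuclideanSpace ℝ (Fin n) => a ‖z‖) ⊆ Metric.ball 0 δ)
    (S : Set (EuclideanSpace ℝ (Fin n))) (x : EuclideanSpace ℝ (Fin n)) :
    ∫ y in S, nonlocalDensity a (fun _ _ => 1) φ φ (x, y) ≤ ‖gradient φ x‖ ^ 2 + C * n * δ := by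
  obtain ⟨hint, heq⟩ := integral_radial_mul_inner_sq ha (gradient φ x)
  have hn' : (n : ℝ) ≠ 0 := Nat.cast_ne_zero.2 hn
  rw [ha1, mul_comm (‖gradient φ x‖ ^ 2)] at heq
  have heq := mul_left_cancel₀ hn' heq
  set H : EuclideanSpace ℝ (Fin n) → ℝ := fun z =>
    a ‖z‖ * (⟪gradient φ x, z⟫_ℝ / ‖z‖) ^ 2 + a ‖z‖ * (C * δ)
  have hH : Integrable H := hint.add (ha.mul_const _)
  have hle : ∀ y, nonlocalDensity a (fun _ _ => 1) φ φ (x, y) ≤ H (x - y) := fun y => by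
    simp only [nonlocalDensity, one_mul, H]
    rw [mul_assoc, ← mul_add]
    by_cases h0 : a ‖x - y‖ = 0
    · simp [h0]
    have hδ : ‖x - y‖ < δ := by simpa using hsupp h0
    refine mul_le_mul_of_nonneg_left ?_ (ha0 _ (norm_nonneg _))
    -- On the diagonal the quotients are `0 / 0 = 0`.
    rcases eq_or_ne ‖x - y‖ 0 with h | h
    · have : 0 ≤ C * δ := mul_nonneg hC (h ▸ hδ.le)
      simpa [h] using this
    have hpos : 0 < ‖x - y‖ ^ 2 := by positivity
    have h1 : C * ‖x - y‖ ^ 3 ≤ C * δ * ‖x - y‖ ^ 2 := by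
      rw [pow_succ', ← mul_assoc]
      gcongr
    rw [← sq, div_pow, div_pow, div_add' _ _ _ hpos.ne']
    gcongr
    linarith [hφ x y]
  calc ∫ y in S, nonlocalDensity a (fun _ _ => 1) φ φ (x, y)
      ≤ ∫ y in S, H (x - y) :=
        integral_mono_of_nonneg (ae_of_all _ fun y => nonlocalDensity_self_nonneg ha0 φ (x, y))
          (hH.comp_sub_left x).integrableOn (ae_of_all _ hle)
    _ ≤ ∫ y, H (x - y) :=
        setIntegral_le_integral (hH.comp_sub_left x) (ae_of_all _ fun y =>
          (nonlocalDensity_self_nonneg ha0 φ (x, y)).trans (hle y))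
    _ = ‖gradient φ x‖ ^ 2 + C * n * δ := by
        rw [integral_sub_left_eq_self H volume x, integral_add hint (ha.mul_const _), heq,
          integral_mul_const, ha1]
        ring

/-- By the arithmetic-geometric mean inequality and the symmetry of the energy density, the
geometric mean of the conductivities can be replaced by the conductivity at one of the points. -/
theorem setIntegral_simpConductivity_mul_le {p ρmin ρmax : ℝ} (hp : 0 ≤ p) (hρmin : 0 ≤ ρmin)
    {ρ : EuclideanSpace ℝ (Fin n) → ℝ} {S : Set (EuclideanSpace ℝ (Fin n))}
    (hρm : AEStronglyMeasurable ρ (volume.restrict S))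
    (hρ : ∀ᵐ x ∂(volume.restrict S), ρ x ∈ Icc ρmin ρmax)
    {g : EuclideanSpace ℝ (Fin n) × EuclideanSpace ℝ (Fin n) → ℝ} (hg : IntegrableOn g (S ×ˢ S))
    (hg0 : ∀ z, 0 ≤ g z) (hgs : ∀ z, g z.swap = g z) :
    IntegrableOn (fun z => ρ z.1 ^ p * g z) (S ×ˢ S) ∧
    ∫ z in S ×ˢ S, simpConductivity p ρ z.1 z.2 * g z ≤ ∫ z in S ×ˢ S, ρ z.1 ^ p * g z := by
  have hm : AEStronglyMeasurable (fun x => ρ x ^ p) (volume.restrict S) :=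
    (hρm.aemeasurable.pow_const _).aestronglyMeasurable
  obtain ⟨h1, h2⟩ := aestronglyMeasurable_prod_fst_snd hm
  have hb : ∀ t ∈ Icc ρmin ρmax, ‖t ^ p‖ ≤ ρmax ^ p := fun t ht => by
    have ht0 := hρmin.trans ht.1
    rw [Real.norm_of_nonneg (Real.rpow_nonneg ht0 _)]
    exact Real.rpow_le_rpow ht0 ht.2 hp
  have I1 : IntegrableOn (fun z => ρ z.1 ^ p * g z) (S ×ˢ S) :=
    Integrable.bdd_mul (c := ρmax ^ p) hg h1 ((ae_prod_of_ae hρ).mono fun z hz => hb _ hz.1)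
  have I2 : IntegrableOn (fun z => ρ z.2 ^ p * g z) (S ×ˢ S) :=
    Integrable.bdd_mul (c := ρmax ^ p) hg h2 ((ae_prod_of_ae hρ).mono fun z hz => hb _ hz.2)
  refine ⟨I1, ?_⟩
  have hswap : ∫ z in S ×ˢ S, ρ z.2 ^ p * g z = ∫ z in S ×ˢ S, ρ z.1 ^ p * g z := by
    rw [Measure.volume_eq_prod, ← setIntegral_prod_swap S S]
    simp [hgs]
  calc ∫ z in S ×ˢ S, simpConductivity p ρ z.1 z.2 * g z
      ≤ ∫ z in S ×ˢ S, (ρ z.1 ^ p * g z + ρ z.2 ^ p * g z) * (1 / 2) := by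
        refine integral_mono_ae (hg.simpConductivity_mul hp hρmin hρm hρ)
          ((I1.add I2).mul_const _) ?_
        filter_upwards [ae_prod_of_ae hρ] with z hz
        have h := mul_le_mul_of_nonneg_right (simpConductivity_le (p := p)
          (hρmin.trans hz.1.1) (hρmin.trans hz.2.1)) (hg0 z)
        linarith
    _ = ∫ z in S ×ˢ S, ρ z.1 ^ p * g z := by
        rw [integral_mul_const, integral_add I1 I2, hswap]
        ring

/-- The nonlocal energy of a test function is asymptotically at most the local energy for the same
material distribution. -/
theorem nonlocalForm_simpConductivity_le {Ω : Set (EuclideanSpace ℝ (Fin n))}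
    {φ : EuclideanSpace ℝ (Fin n) → ℝ} (hφ : IsTestFunction Ω φ) {C : ℝ} (hC : 0 ≤ C)
    (hφC : ∀ x y, (φ x - φ y) ^ 2 ≤ ⟪gradient φ x, x - y⟫_ℝ ^ 2 + C * ‖x - y‖ ^ 3)
    (hn : n ≠ 0) {A : ℝ → ℝ → ℝ} {δ δ₀ : ℝ} (hδ : 0 ≤ δ) (hδδ₀ : δ ≤ δ₀)
    (ha : Integrable fun z : EuclideanSpace ℝ (Fin n) => A δ ‖z‖)
    (ha0 : ∀ r, 0 ≤ r → 0 ≤ A δ r)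
    (ha1 : ∫ z : EuclideanSpace ℝ (Fin n), A δ ‖z‖ = n)
    (hsupp : Function.support (fun z : EuclideanSpace ℝ (Fin n) => A δ ‖z‖) ⊆ Metric.ball 0 δ)
    (hSfin : volume (Metric.thickening δ₀ Ω) ≠ ⊤)
    {p ρmin ρmax : ℝ} (hp : 0 ≤ p) (hρmin : 0 ≤ ρmin) {ρ : EuclideanSpace ℝ (Fin n) → ℝ}
    (hρm : AEStronglyMeasurable ρ (volume.restrict (Metric.thickening δ₀ Ω)))
    (hρ : ∀ᵐ x ∂(volume.restrict (Metric.thickening δ₀ Ω)), ρ x ∈ Icc ρmin ρmax) :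
    nonlocalForm Ω A δ (simpConductivity p ρ) φ φ ≤
      (∫ x in Metric.thickening δ₀ Ω, ρ x ^ p * ‖gradient φ x‖ ^ 2) +
        volume.real (Metric.thickening δ₀ Ω) * (ρmax ^ p * (C * n * δ)) := by
  have hsub : Metric.thickening δ Ω ⊆ Metric.thickening δ₀ Ω := Metric.thickening_mono hδδ₀ Ω
  have hμ : volume.restrict (Metric.thickening δ Ω) ≤ volume.restrict (Metric.thickening δ₀ Ω) :=
    Measure.restrict_mono_set _ hsub
  have hS : MeasurableSet (Metric.thickening δ Ω) := Metric.isOpen_thickening.measurableSet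
  have hρm' := hρm.mono_measure hμ
  have hρ' := ae_mono hμ hρ
  have hg := hφ.integrableOn_nonlocalDensity ha ha0 hS (measure_ne_top_of_subset hsub hSfin)
  obtain ⟨hI, hle⟩ := setIntegral_simpConductivity_mul_le hp hρmin hρm' hρ' hg
    (nonlocalDensity_self_nonneg ha0 φ)
    (fun z => by
      simp only [nonlocalDensity, Prod.fst_swap, Prod.snd_swap]
      rw [norm_sub_rev, ← neg_sub (φ z.1)]
      ring)
  have hm : AEStronglyMeasurable (fun x => ρ x ^ p)
      (volume.restrict (Metric.thickening δ₀ Ω)) :=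
    (hρm.aemeasurable.pow_const _).aestronglyMeasurable
  have hb : ∀ᵐ x ∂(volume.restrict (Metric.thickening δ₀ Ω)), 0 ≤ ρ x ^ p ∧ ρ x ^ p ≤ ρmax ^ p :=
    hρ.mono fun x hx => ⟨Real.rpow_nonneg (hρmin.trans hx.1) _,
      Real.rpow_le_rpow (hρmin.trans hx.1) hx.2 hp⟩
  have hb' : ∀ᵐ x ∂(volume.restrict (Metric.thickening δ₀ Ω)), ‖ρ x ^ p‖ ≤ ρmax ^ p :=
    hb.mono fun x hx => (Real.norm_of_nonneg hx.1).trans_le hx.2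
  have : IsFiniteMeasure (volume.restrict (Metric.thickening δ₀ Ω)) :=
    isFiniteMeasure_restrict.2 hSfin
  have hgrad : IntegrableOn (fun x => ‖gradient φ x‖ ^ 2) (Metric.thickening δ₀ Ω) :=
    ((hφ.continuous_gradient.memLp_of_hasCompactSupport (p := 2)
      hφ.hasCompactSupport_gradient).integrable_norm_pow (by simp)).integrableOn
  have J1 : IntegrableOn (fun x => ρ x ^ p * ‖gradient φ x‖ ^ 2) (Metric.thickening δ₀ Ω) :=
    Integrable.bdd_mul hgrad hm hb'
  have J2 : IntegrableOn (fun x => ρ x ^ p * (C * n * δ)) (Metric.thickening δ₀ Ω) :=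
    Integrable.bdd_mul (integrable_const _) hm hb'
  have hK : 0 ≤ C * n * δ := by positivity
  calc nonlocalForm Ω A δ (simpConductivity p ρ) φ φ
      = ∫ z in Metric.thickening δ Ω ×ˢ Metric.thickening δ Ω,
          simpConductivity p ρ z.1 z.2 * nonlocalDensity (A δ) (fun _ _ => 1) φ φ z :=
        integral_congr_ae (ae_of_all _ (nonlocalDensity_eq_mul _ _ _ _))
    _ ≤ ∫ x in Metric.thickening δ Ω, ∫ y in Metric.thickening δ Ω,
          ρ x ^ p * nonlocalDensity (A δ) (fun _ _ => 1) φ φ (x, y) :=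
        hle.trans_eq (setIntegral_prod _ hI)
    _ ≤ ∫ x in Metric.thickening δ Ω,
          (ρ x ^ p * ‖gradient φ x‖ ^ 2 + ρ x ^ p * (C * n * δ)) := by
        refine integral_mono_of_nonneg ?_ (Integrable.mono_measure (J1.add J2) hμ) ?_
        · filter_upwards [ae_mono hμ hb] with x hx
          exact integral_nonneg fun y => mul_nonneg hx.1 (nonlocalDensity_self_nonneg ha0 φ _)
        · filter_upwards [ae_mono hμ hb] with x hx
          rw [integral_const_mul, ← mul_add]
          exact mul_le_mul_of_nonneg_left
            (setIntegral_nonlocalDensity_le hC hφC hn ha ha0 ha1 hsupp _ x) hx.1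
    _ ≤ ∫ x in Metric.thickening δ₀ Ω,
          (ρ x ^ p * ‖gradient φ x‖ ^ 2 + ρ x ^ p * (C * n * δ)) := by
        refine integral_mono_measure hμ (hb.mono fun x hx => ?_) (J1.add J2)
        exact add_nonneg (mul_nonneg hx.1 (sq_nonneg _)) (mul_nonneg hx.1 hK)
    _ ≤ _ := by
        rw [integral_add J1 J2]
        gcongr
        calc ∫ x in Metric.thickening δ₀ Ω, ρ x ^ p * (C * n * δ)
            ≤ ∫ _ in Metric.thickening δ₀ Ω, ρmax ^ p * (C * n * δ) :=
              integral_mono_ae J2 (integrable_const _)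
                (hb.mono fun x hx => mul_le_mul_of_nonneg_right hx.2 hK)
          _ = _ := by simp

/-! ### Continuity of the local energy -/

theorem tendsto_integral_inner_of_tendsto_eLpNorm {α V ι : Type*} [MeasurableSpace α]
    {μ : Measure α} [NormedAddCommGroup V] [InnerProductSpace ℝ V] {l : Filter ι}
    {F G : ι → α → V} {F' G' : α → V}
    (hF : ∀ i, MemLp (F i) 2 μ) (hG : ∀ i, MemLp (G i) 2 μ)
    (hF' : MemLp F' 2 μ) (hG' : MemLp G' 2 μ)
    (hFl : Tendsto (fun i => eLpNorm (F i - F') 2 μ) l (𝓝 0))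
    (hGl : Tendsto (fun i => eLpNorm (G i - G') 2 μ) l (𝓝 0)) :
    Tendsto (fun i => ∫ x, ⟪F i x, G i x⟫_ℝ ∂μ) l (𝓝 (∫ x, ⟪F' x, G' x⟫_ℝ ∂μ)) := by
  have key : ∀ {f g : α → V} (hf : MemLp f 2 μ) (hg : MemLp g 2 μ),
      ⟪hf.toLp f, hg.toLp g⟫_ℝ = ∫ x, ⟪f x, g x⟫_ℝ ∂μ := fun hf hg => by
    rw [L2.inner_def]
    refine integral_congr_ae ?_
    filter_upwards [hf.coeFn_toLp, hg.coeFn_toLp] with x h1 h2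
    rw [h1, h2]
  simpa only [key] using Filter.Tendsto.inner (𝕜 := ℝ)
    ((Lp.tendsto_Lp_iff_tendsto_eLpNorm'' F hF F' hF').2 hFl)
    ((Lp.tendsto_Lp_iff_tendsto_eLpNorm'' G hG G' hG').2 hGl)

/-- The compliance of the local problem is approached by the dual functional at test functions. -/
theorem IsLocalState.exists_isTestFunction_lt {Ω : Set (EuclideanSpace ℝ (Fin n))}
    {f k u : EuclideanSpace ℝ (Fin n) → ℝ} (hu : IsLocalState Ω f k u)
    (hf : MemLp f 2 (volume.restrict Ω))
    (hkm : AEStronglyMeasurable k (volume.restrict Ω)) {K : ℝ}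
    (hk : ∀ᵐ x ∂(volume.restrict Ω), k x ∈ Icc 0 K) {b : ℝ} (hb : b < load Ω f u) :
    ∃ φ, IsTestFunction Ω φ ∧
      b < 2 * load Ω f φ - ∫ x in Ω, k x * ‖gradient φ x‖ ^ 2 := by
  obtain ⟨G, hG, hsol⟩ := hu
  choose φ hφ hlt using fun j : ℕ => hG.closure (1 / ((j : ℝ) + 1)) Nat.one_div_pos_of_nat
  have h0 : Tendsto (fun j : ℕ => ENNReal.ofReal (1 / ((j : ℝ) + 1))) atTop (𝓝 0) := by
    simpa using ENNReal.tendsto_ofReal tendsto_one_div_add_atTop_nhds_zero_nat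
  have hφ2 : ∀ j, MemLp (φ j) 2 (volume.restrict Ω) := fun j =>
    ((hφ j).smooth.continuous.memLp_of_hasCompactSupport (hφ j).compact).restrict _
  have hgr2 : ∀ j, MemLp (gradient (φ j)) 2 (volume.restrict Ω) := fun j =>
    ((hφ j).continuous_gradient.memLp_of_hasCompactSupport
      (hφ j).hasCompactSupport_gradient).restrict _
  have hlim1 : Tendsto (fun j => eLpNorm (φ j - u) 2 (volume.restrict Ω)) atTop (𝓝 0) :=
    tendsto_of_tendsto_of_tendsto_of_le_of_le tendsto_const_nhds h0 (fun _ => zero_le)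
      fun j => (eLpNorm_sub_comm _ _ _ _).trans_le (le_self_add.trans (hlt j).le)
  have hlim2 : Tendsto (fun j => eLpNorm (gradient (φ j) - G) 2 (volume.restrict Ω))
      atTop (𝓝 0) :=
    tendsto_of_tendsto_of_tendsto_of_le_of_le tendsto_const_nhds h0 (fun _ => zero_le)
      fun j => (eLpNorm_sub_comm _ _ _ _).trans_le (le_add_self.trans (hlt j).le)
  -- The weighted gradients `√k ∇φ` carry the local energy as their squared `L²` norm.
  have hsm : AEStronglyMeasurable (fun x => √(k x)) (volume.restrict Ω) :=
    Real.continuous_sqrt.comp_aestronglyMeasurable hkm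
  have hsb : ∀ᵐ x ∂(volume.restrict Ω), ‖√(k x)‖ ≤ √K := hk.mono fun x hx => by
    rw [Real.norm_of_nonneg (Real.sqrt_nonneg _)]
    exact Real.sqrt_le_sqrt hx.2
  have hbound : ∀ g : EuclideanSpace ℝ (Fin n) → EuclideanSpace ℝ (Fin n),
      ∀ᵐ x ∂(volume.restrict Ω), ‖√(k x) • g x‖ ≤ √K * ‖g x‖ := fun g => hsb.mono fun x hx => by
    rw [norm_smul]
    gcongr
  have hw : ∀ g : EuclideanSpace ℝ (Fin n) → EuclideanSpace ℝ (Fin n),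
      MemLp g 2 (volume.restrict Ω) →
      MemLp (fun x => √(k x) • g x) 2 (volume.restrict Ω) := fun g hg =>
    hg.of_le_mul (hsm.smul hg.1) (hbound g)
  have hlim3 : Tendsto (fun j => eLpNorm ((fun x => √(k x) • gradient (φ j) x) -
      fun x => √(k x) • G x) 2 (volume.restrict Ω)) atTop (𝓝 0) := by
    have h := ENNReal.Tendsto.const_mul hlim2 (Or.inr (ENNReal.ofReal_ne_top (r := √K)))
    rw [mul_zero] at h
    refine tendsto_of_tendsto_of_tendsto_of_le_of_le tendsto_const_nhds h (fun _ => zero_le)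
      fun j => eLpNorm_le_mul_eLpNorm_of_ae_le_mul ?_ 2
    filter_upwards [hbound (gradient (φ j) - G)] with x hx
    simpa [smul_sub] using hx
  have hsq : ∀ g : EuclideanSpace ℝ (Fin n) → EuclideanSpace ℝ (Fin n),
      ∫ x in Ω, ⟪√(k x) • g x, √(k x) • g x⟫_ℝ = ∫ x in Ω, k x * ‖g x‖ ^ 2 := fun g => by
    refine integral_congr_ae (hk.mono fun x hx => ?_)
    simp only [real_inner_self_eq_norm_sq]
    rw [norm_smul, mul_pow, Real.norm_eq_abs, sq_abs, Real.sq_sqrt hx.1]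
  have hE := tendsto_integral_inner_of_tendsto_eLpNorm (fun j => hw _ (hgr2 j))
    (fun j => hw _ (hgr2 j)) (hw _ hG.memLp_grad) (hw _ hG.memLp_grad) hlim3 hlim3
  simp only [hsq] at hE
  have hload : Tendsto (fun j => load Ω f (φ j)) atTop (𝓝 (load Ω f u)) := by
    have := tendsto_integral_inner_of_tendsto_eLpNorm hφ2 (fun _ => hf) hG.memLp hf hlim1
      (by simp)
    simpa [load, real_inner_eq_re_inner] using this
  have hval : ∫ x in Ω, k x * ‖G x‖ ^ 2 = load Ω f u := by
    rw [← hsol u G hG]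
    simp only [real_inner_self_eq_norm_sq]
  have hlim := (hload.const_mul 2).sub hE
  rw [hval, two_mul, add_sub_cancel_right] at hlim
  obtain ⟨j, hj⟩ := (hlim.eventually_const_lt hb).exists
  exact ⟨φ j, hφ j, hj⟩

end NonlocalSIMP

/-! ### The lower bound for the compliances -/

theorem mainTheorem2 {n : ℕ} (hn : 2 ≤ n)
    (Ω : Set (EuclideanSpace ℝ (Fin n)))
    (hΩ_open : IsOpen Ω) (hΩ_bdd : Bornology.IsBounded Ω) (hΩ_conn : IsConnected Ω)
    (f : EuclideanSpace ℝ (Fin n) → ℝ) (hf : MemLp f 2 (volume.restrict Ω))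
    (A : ℝ → ℝ → ℝ) (hA : NonlocalSIMP.IsAdmissibleKernel n A)
    (p : ℝ) (hp : 1 ≤ p)
    (ρmin ρmax : ℝ) (hρmin : 0 < ρmin) (hρmax : ρmin < ρmax)
    (δ₀ : ℝ) (hδ₀ : 0 < δ₀)
    -- the material distributions, elements of `L^∞(Ω_{δ₀})`
    (ρδ : ℝ → EuclideanSpace ℝ (Fin n) → ℝ) (ρ : EuclideanSpace ℝ (Fin n) → ℝ)
    (hρδ_mem : ∀ δ ∈ Ioo 0 δ₀, MemLp (ρδ δ) ∞ (volume.restrict (Metric.thickening δ₀ Ω)))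
    (hρ_mem : MemLp ρ ∞ (volume.restrict (Metric.thickening δ₀ Ω)))
    (hρδ : ∀ δ ∈ Ioo 0 δ₀, ∀ᵐ x ∂(volume.restrict (Metric.thickening δ₀ Ω)),
      ρδ δ x ∈ Icc ρmin ρmax)
    (hρ : ∀ᵐ x ∂(volume.restrict (Metric.thickening δ₀ Ω)), ρ x ∈ Icc ρmin ρmax)
    -- `δ → 0` along `l`: either `l = 𝓝[>] 0`, or the filter of a sequence `δ_j → 0`, `δ_j > 0`
    (l : Filter ℝ) (hl : l ≤ 𝓝[>] 0)
    (hconv : NonlocalSIMP.WeakStarTendsto (Metric.thickening δ₀ Ω)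
      (fun δ x => ρδ δ x ^ p) l (fun x => ρ x ^ p))
    -- the states
    (uδ : ℝ → EuclideanSpace ℝ (Fin n) → ℝ) (u : EuclideanSpace ℝ (Fin n) → ℝ)
    (huδ : ∀ δ ∈ Ioo 0 δ₀,
      NonlocalSIMP.IsNonlocalState Ω f A δ (NonlocalSIMP.simpConductivity p (ρδ δ)) (uδ δ))
    (hu : NonlocalSIMP.IsLocalState Ω f (fun x => ρ x ^ p) u) :
    ((NonlocalSIMP.load Ω f u : ℝ) : EReal) ≤
      liminf (fun δ => ((NonlocalSIMP.load Ω f (uδ δ) : ℝ) : EReal)) l := by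
  have hn0 : n ≠ 0 := by omega
  have hn' : (n : ℝ) ≠ 0 := Nat.cast_ne_zero.2 hn0
  have hp0 : 0 ≤ p := zero_le_one.trans hp
  have hSfin : volume (Metric.thickening δ₀ Ω) ≠ ⊤ := hΩ_bdd.thickening.measure_lt_top.ne
  have hsub : Ω ⊆ Metric.thickening δ₀ Ω := Metric.self_subset_thickening hδ₀ Ω
  have hμ : volume.restrict Ω ≤ volume.restrict (Metric.thickening δ₀ Ω) :=
    Measure.restrict_mono_set _ hsub
  have hρΩ : ∀ᵐ x ∂(volume.restrict Ω), ρ x ∈ Icc ρmin ρmax := ae_mono hμ hρ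
  refine EReal.ge_of_forall_gt_iff_ge.1 fun b hb => ?_
  obtain ⟨φ, hφ, hbφ⟩ := hu.exists_isTestFunction_lt hf (K := ρmax ^ p)
    ((hρ_mem.1.mono_measure hμ).aemeasurable.pow_const _).aestronglyMeasurable
    (hρΩ.mono fun x hx => ⟨Real.rpow_nonneg (hρmin.le.trans hx.1) _,
      Real.rpow_le_rpow (hρmin.le.trans hx.1) hx.2 hp0⟩) (EReal.coe_lt_coe_iff.1 hb)
  obtain ⟨C, hC, hφC⟩ := hφ.exists_sq_sub_le
  -- The gradient of `φ` vanishes outside `Ω`.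
  have hE : ∫ x in Metric.thickening δ₀ Ω, ρ x ^ p * ‖gradient φ x‖ ^ 2 =
      ∫ x in Ω, ρ x ^ p * ‖gradient φ x‖ ^ 2 :=
    setIntegral_eq_of_subset_of_forall_sdiff_eq_zero Metric.isOpen_thickening.measurableSet hsub
      fun x hx => by rw [hφ.gradient_eq_zero hx.2]; simp
  have hgrad : IntegrableOn (fun x => ‖gradient φ x‖ ^ 2) (Metric.thickening δ₀ Ω) :=
    ((hφ.continuous_gradient.memLp_of_hasCompactSupport (p := 2)
      hφ.hasCompactSupport_gradient).integrable_norm_pow (by simp)).integrableOn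
  have hδ : Tendsto (fun δ : ℝ => δ) l (𝓝 0) := tendsto_id'.2 (hl.trans nhdsWithin_le_nhds)
  have hlim : Tendsto (fun δ => 2 * NonlocalSIMP.load Ω f φ -
      ((∫ x in Metric.thickening δ₀ Ω, ρδ δ x ^ p * ‖gradient φ x‖ ^ 2) +
        volume.real (Metric.thickening δ₀ Ω) * (ρmax ^ p * (C * n * δ)))) l
      (𝓝 (2 * NonlocalSIMP.load Ω f φ - ∫ x in Ω, ρ x ^ p * ‖gradient φ x‖ ^ 2)) := by
    have h := ((hconv _ hgrad).add
      (((hδ.const_mul (C * n)).const_mul (ρmax ^ p)).const_mul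
        (volume.real (Metric.thickening δ₀ Ω)))).const_sub (2 * NonlocalSIMP.load Ω f φ)
    simpa only [mul_zero, add_zero, hE] using h
  refine le_liminf_of_le (by isBoundedDefault) ?_
  filter_upwards [hlim.eventually_const_lt hbφ, hl (Ioo_mem_nhdsGT hδ₀)] with δ hbδ hδmem
  have hδsub : volume.restrict (Metric.thickening δ Ω) ≤
      volume.restrict (Metric.thickening δ₀ Ω) :=
    Measure.restrict_mono_set _ (Metric.thickening_mono hδmem.2.le Ω)
  have ha1 : ∫ x : EuclideanSpace ℝ (Fin n), A δ ‖x‖ = n := by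
    have := hA.normalized δ hδmem.1
    field_simp at this
    exact this
  have ha : Integrable fun x : EuclideanSpace ℝ (Fin n) => A δ ‖x‖ :=
    .of_integral_ne_zero (ha1 ▸ hn')
  have ha0 := hA.nonneg δ hδmem.1
  have hρm := (hρδ_mem δ hδmem).1
  have h1 := (huδ δ hδmem).two_mul_load_sub_le hΩ_open.measurableSet ha ha0
    (measure_ne_top_of_subset (Metric.thickening_mono hδmem.2.le Ω) hSfin) hp0 hρmin.le
    (hρm.mono_measure hδsub) (ae_mono hδsub (hρδ δ hδmem)) hφ
  have h2 := NonlocalSIMP.nonlocalForm_simpConductivity_le hφ hC hφC hn0 hδmem.1.le hδmem.2.le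
    ha ha0 ha1 (hA.supp δ hδmem.1) hSfin hp0 hρmin.le hρm (hρδ δ hδmem)
  exact EReal.coe_le_coe_iff.2 (by linarith)
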